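/- For a finite simple graph $G$ on $v(G)=2n$ vertices let $m_k(G)$ be the number of its $k$-matchings, and let $M(G,t)=\sum_{k=0}^{n}m_k(G)t^k=\prod_{k=1}^{n}(1+\gamma_k(G)t)$, where $\gamma_1(G)\le\dots\le\gamma_n(G)$ are real. Let $p(G,t)=\frac{t\,M'(G,t)}{n\,M(G,t)}$, let $p^*(G)=2\nu(G)/v(G)$, where $\nu(G)$ is the size of a largest matching, and let $t(G,\cdot):[0,p^*(G))\to[0,\infty)$ be the inverse of the strictly increasing function $t\mapsto p(G,t)$ on $[0,\infty)$. The entropy function is $$\lambda_G(p)=\frac{\ln M(G,t)}{v(G)}-\frac12\,p\ln t,\qquad t=t(G,p),$$ for $0\le p<p^*(G)$; it is extended to $p=p^*(G)$ by its left limit and by $0$ to $p>p^*(G)$. If $G$ is $d$-regular, its gap function is $$g_G(p)=\lambda_G(p)-\frac12\Bigl(p\ln\frac dp+(d-p)\ln\Bigl(1-\frac pd\Bigr)-2(1-p)\ln(1-p)\Bigr),\qquad 0\le p\le 1,$$ with the convention $0\ln 0=0$ (so $0\ln(d/0)=0$). **Proposition.** For every integer $d\ge 3$ there are constants $0<c<1$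 and $K>1$ and a sequence $(H_i)$ of $d$-regular bipartite finite simple graphs, with $v(H_i)=2n_i$ vertices, $1\le n_1<n_2<\cdots$, such that for every $i$: 1. $\gamma_1(H_i)<c^{\,v(H_i)}$; 2. $m_{n_i}(H_i)>0$ and $\dfrac{m_{n_i-1}(H_i)}{m_{n_i}(H_i)}>K^{\,n_i}$; 3. there is $p_0\in(0,1)$ at which $g_{H_i}$ is differentiable with $g_{H_i}'(p_0)<0$; 4. consequently each of the following three statements, which hold for all $d$-regular vertex-transitive bipartite graphs $G$ on $2n$ vertices, fails for $G=H_i$: that $g_G$ is monotone increasing on $[0,1]$; that $\gamma_k(G)\ge\frac{d^2}{4(d-1)}\frac{k^2}{n^2}$ for all $1\le k\le n$ (it fails for $k=1$); and that $\frac{m_{n-1}(G)}{m_n(G)}\le\frac2d n^2$. -/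

import Mathlib

open Polynomial Filter Topology

noncomputable section

namespace Matchings

variable {V : Type*}

/-- `M` is a `k`-matching of `G`: a set of `k` edges, no two of which share a vertex. -/
def IsKMatching (G : SimpleGraph V) (k : ℕ) (M : Finset (Sym2 V)) : Prop :=
  (∀ e ∈ M, e ∈ G.edgeSet) ∧ M.card = k ∧
    ∀ e ∈ M, ∀ f ∈ M, e ≠ f → ∀ v : V, ¬ (v ∈ e ∧ v ∈ f)

/-- The number `m_k(G)` of `k`-matchings of `G`. -/
def numMatchings (G : SimpleGraph V) (k : ℕ) : ℕ :=
  {M : Finset (Sym2 V) | IsKMatching G k M}.ncard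

/-- The size `ν(G)` of a largest matching of a finite graph `G`. -/
def matchingNumber (G : SimpleGraph V) : ℕ :=
  sSup {k : ℕ | ∃ M : Finset (Sym2 V), IsKMatching G k M}

variable [Fintype V]

/-- The matching generating function `M(G,t) = ∑ₖ m_k(G) tᵏ`, as a real polynomial in `t`. -/
def genPoly (G : SimpleGraph V) : ℝ[X] :=
  ∑ k ∈ Finset.range (Fintype.card V / 2 + 1), C (numMatchings G k : ℝ) * X ^ k

/-- The density function `p(G,t) = t M'(G,t) / (n M(G,t))`, where `n = v(G)/2`. -/
def density (G : SimpleGraph V) (t : ℝ) : ℝ :=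
  t * (derivative (genPoly G)).eval t / (((Fintype.card V : ℝ) / 2) * (genPoly G).eval t)

/-- `F(G,t) = ln M(G,t) / v(G) - p(G,t) ln(t) / 2`. -/
def freeEntropy (G : SimpleGraph V) (t : ℝ) : ℝ :=
  Real.log ((genPoly G).eval t) / (Fintype.card V : ℝ) - 1 / 2 * density G t * Real.log t

/-- `p*(G) = 2 ν(G) / v(G)`. -/
def maxDensity (G : SimpleGraph V) : ℝ :=
  2 * (matchingNumber G : ℝ) / (Fintype.card V : ℝ)

/-- The inverse `t(G,p)` on `[0, p*(G))` of the strictly increasing function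
`t ↦ p(G,t)` on `[0,∞)`. -/
def activity (G : SimpleGraph V) (p : ℝ) : ℝ :=
  Function.invFunOn (density G) (Set.Ici 0) p

/-- The entropy function `λ_G(p)`: it is `F(G, t(G,p))` for `p < p*(G)`, its left limit at
`p = p*(G)`, and `0` for `p > p*(G)`. -/
def entropy (G : SimpleGraph V) (p : ℝ) : ℝ :=
  if p < maxDensity G then freeEntropy G (activity G p)
  else if p = maxDensity G then
    limUnder (𝓝[<] maxDensity G) (fun q => freeEntropy G (activity G q))
  else 0

/-- Gurvits's function
`𝔾_d(p) = (p ln(d/p) + (d-p) ln(1-p/d) - 2(1-p) ln(1-p)) / 2`. -/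
def gurvits (d : ℕ) (p : ℝ) : ℝ :=
  1 / 2 * (p * Real.log (d / p) + (d - p) * Real.log (1 - p / d)
    - 2 * (1 - p) * Real.log (1 - p))

/-- The gap function `g(p) = λ_G(p) - 𝔾_d(p)` of a `d`-regular graph `G`. -/
def gap (d : ℕ) (G : SimpleGraph V) (p : ℝ) : ℝ :=
  entropy G p - gurvits d p

/-- `γ 1 ≤ γ 2 ≤ ⋯ ≤ γ n` are the numbers `γ_k(G)` of a graph on `2n` vertices:
`M(G,t) = ∏_{k=1}^n (1 + γ_k t)`. (Only the values of `γ` on `{1,…,n}` are relevant,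
and they are determined by `G`.) -/
def IsGammaSeq (G : SimpleGraph V) (n : ℕ) (γ : ℕ → ℝ) : Prop :=
  Fintype.card V = 2 * n ∧ MonotoneOn γ (Set.Icc 1 n) ∧
    genPoly G = ∏ k ∈ Finset.Icc 1 n, (1 + C (γ k) * X)

end Matchings

end

/-!
The graph `H` consists of `d` chains of blocks. A block is a `K_{d,d}` minus one edge, whose ends
are the special vertices of the block; consecutive blocks of a chain are linked by an edge between
special vertices. An extra left vertex is joined to the heads of all chains and an extra right
vertex to their tails, which makes the graph `d`-regular. It is the union of `d` explicit
permutations (`chainColor`), which gives both the regularity and a perfect matching.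

A perfect matching covers the extra left vertex by the link to some chain, and by a pigeonhole
argument in each block it then uses all the links of that chain (`exists_apply_eq_special`). If the
two extra vertices are left uncovered instead, those links can be released: in each block of
the chain the special vertices are matched inside the block, which can be done in `d - 1` times
as many ways. Hence `(d - 1) ^ k * m_n ≤ d * m_{n-1}` for chains of `k` blocks
(`pow_mul_numMatchings_chain_le`), while `n = d ^ 2 * k + 1` is linear in `k`.

The matching generating function has only real negative zeros (Heilmann–Lieb,
`exists_neg_of_aeval_genPoly_eq_zero`), so the numbers `γ_k` exist and are positive, and
`m_{n-1} / m_n = ∑ 1 / γ_k ≤ n / γ_1` shows that `γ_1` is exponentially small. Finally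
`λ_G'(p) = -(ln t) / 2` at `p = p(G,t)` (`hasDerivAt_entropy`), whereas Gurvits's function has
derivative `ln (d² (1 - p)² / (p (d - p))) / 2`. At `t = 1 / γ_1` the factor `1 + γ_1 t` contributes
`1 / (2n)` to `1 - p`, so the sum of `(ln t) / 2` and this derivative is positive as soon as
`γ_1 < d / (4 n²)` (`exists_hasDerivAt_gap_neg`), and the gap function decreases there.
-/

/-! ### Zeros of the matching generating function -/

namespace Matchings

theorem numMatchings_zero {V : Type*} (G : SimpleGraph V) : numMatchings G 0 = 1 := by
  rw [numMatchings, Set.ncard_eq_one]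
  refine ⟨∅, Set.ext fun M => ?_⟩
  simp only [IsKMatching, Set.mem_ofPred_eq, Finset.card_eq_zero, Set.mem_singleton_iff]
  constructor
  · exact fun h => h.2.1
  · rintro rfl
    simp

variable {V : Type*} [Fintype V]

open Classical in
/-- The matchings of `G`, of any size, all of whose edges lie inside the vertex set `S`. -/
noncomputable def matchingsIn (G : SimpleGraph V) (S : Finset V) : Finset (Finset (Sym2 V)) :=
  Finset.univ.filter fun M => (∀ e ∈ M, e ∈ G.edgeSet ∧ ∀ v ∈ e, v ∈ S) ∧
    ∀ e ∈ M, ∀ f ∈ M, e ≠ f → ∀ v : V, ¬ (v ∈ e ∧ v ∈ f)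

/-- The matching generating function of the subgraph of `G` induced on `S`, at a complex
argument `t`. -/
noncomputable def matchSum (G : SimpleGraph V) (t : ℂ) (S : Finset V) : ℂ :=
  ∑ M ∈ matchingsIn G S, t ^ M.card

variable {G : SimpleGraph V}

theorem mem_matchingsIn {S : Finset V} {M : Finset (Sym2 V)} :
    M ∈ matchingsIn G S ↔ (∀ e ∈ M, e ∈ G.edgeSet ∧ ∀ v ∈ e, v ∈ S) ∧
      ∀ e ∈ M, ∀ f ∈ M, e ≠ f → ∀ v : V, ¬ (v ∈ e ∧ v ∈ f) := by
  classical
  simp [matchingsIn]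

theorem notMem_of_mem_matchingsIn {S : Finset V} {M : Finset (Sym2 V)}
    (hM : M ∈ matchingsIn G S) {v : V} (hv : v ∉ S) {e : Sym2 V} (hve : v ∈ e) : e ∉ M :=
  fun he => hv (((mem_matchingsIn.1 hM).1 e he).2 v hve)

theorem matchingsIn_mono {S T : Finset V} (h : S ⊆ T) : matchingsIn G S ⊆ matchingsIn G T := by
  intro M hM
  rw [mem_matchingsIn] at hM ⊢
  exact ⟨fun e he => ⟨(hM.1 e he).1, fun v hv => h ((hM.1 e he).2 v hv)⟩, hM.2⟩

theorem insert_mem_matchingsIn [DecidableEq V] {S : Finset V} {u v : V} (hv : v ∈ S) (hu : u ∈ S)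
    (huv : G.Adj v u) {M : Finset (Sym2 V)} (hM : M ∈ matchingsIn G ((S.erase v).erase u)) :
    insert s(v, u) M ∈ matchingsIn G S := by
  have hM' := mem_matchingsIn.1 (matchingsIn_mono
    ((Finset.erase_subset _ _).trans (Finset.erase_subset _ _)) hM)
  have hnot : ∀ w ∈ s(v, u), ∀ e ∈ M, w ∉ e := by
    intro w hw e he hwe
    refine notMem_of_mem_matchingsIn hM (v := w) ?_ hwe he
    rcases Sym2.mem_iff.1 hw with rfl | rfl <;> simp
  rw [mem_matchingsIn]
  refine ⟨?_, ?_⟩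
  · intro e he
    rcases Finset.mem_insert.1 he with rfl | he
    · refine ⟨huv, fun w hw => ?_⟩
      rcases Sym2.mem_iff.1 hw with rfl | rfl <;> assumption
    · exact hM'.1 e he
  · intro e he f hf hne w hw
    rcases Finset.mem_insert.1 he with rfl | he <;> rcases Finset.mem_insert.1 hf with rfl | hf
    · exact hne rfl
    · exact hnot w hw.1 f hf hw.2
    · exact hnot w hw.2 e he hw.1
    · exact hM'.2 e he f hf hne w hw

/-- A matching inside `S` either avoids `v` or consists of an edge `vu` and a matching that avoids
both `v` and `u`. -/
theorem matchingsIn_eq_union [DecidableEq V] [DecidableRel G.Adj] {S : Finset V} {v : V}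
    (hv : v ∈ S) :
    matchingsIn G S = matchingsIn G (S.erase v) ∪
      ((S.erase v).filter (G.Adj v)).biUnion fun u =>
        (matchingsIn G ((S.erase v).erase u)).image (insert s(v, u)) := by
  ext M
  simp only [Finset.mem_union, Finset.mem_biUnion, Finset.mem_filter, Finset.mem_image]
  constructor
  · intro hM
    have hM' := mem_matchingsIn.1 hM
    by_cases h : ∃ e ∈ M, v ∈ e
    · right
      obtain ⟨e, he, hve⟩ := h
      obtain ⟨u, rfl⟩ := Sym2.mem_iff_exists.1 hve
      have hadj : G.Adj v u := (hM'.1 _ he).1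
      refine ⟨u, ⟨Finset.mem_erase.2 ⟨hadj.ne', (hM'.1 _ he).2 u (by simp)⟩, hadj⟩,
        M.erase s(v, u), ?_, Finset.insert_erase he⟩
      rw [mem_matchingsIn]
      refine ⟨fun f hf => ⟨(hM'.1 f (Finset.mem_of_mem_erase hf)).1, fun w hw => ?_⟩,
        fun f hf g hg => hM'.2 f (Finset.mem_of_mem_erase hf) g (Finset.mem_of_mem_erase hg)⟩
      have hd := hM'.2 _ he f (Finset.mem_of_mem_erase hf) (Finset.ne_of_mem_erase hf).symm w
      refine Finset.mem_erase.2 ⟨?_, Finset.mem_erase.2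
        ⟨?_, (hM'.1 f (Finset.mem_of_mem_erase hf)).2 w hw⟩⟩
      · rintro rfl
        exact hd ⟨by simp, hw⟩
      · rintro rfl
        exact hd ⟨by simp, hw⟩
    · left
      push Not at h
      rw [mem_matchingsIn]
      refine ⟨fun e he => ⟨(hM'.1 e he).1, fun w hw => Finset.mem_erase.2
        ⟨?_, (hM'.1 e he).2 w hw⟩⟩, hM'.2⟩
      rintro rfl
      exact h e he hw
  · rintro (hM | ⟨u, ⟨hu, huv⟩, N, hN, rfl⟩)
    · exact matchingsIn_mono (Finset.erase_subset _ _) hM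
    · exact insert_mem_matchingsIn hv (Finset.mem_of_mem_erase hu) huv hN

theorem matchSum_eq_add [DecidableEq V] [DecidableRel G.Adj] (t : ℂ) {S : Finset V} {v : V}
    (hv : v ∈ S) :
    matchSum G t S = matchSum G t (S.erase v) +
      t * ∑ u ∈ (S.erase v).filter (G.Adj v), matchSum G t ((S.erase v).erase u) := by
  have hcov : ∀ u, ∀ N ∈ matchingsIn G ((S.erase v).erase u), s(v, u) ∉ N := fun u N hN =>
    notMem_of_mem_matchingsIn hN (v := v) (by simp) (by simp)
  rw [matchSum, matchingsIn_eq_union hv, Finset.sum_union, Finset.sum_biUnion, Finset.mul_sum]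
  · congr 1
    refine Finset.sum_congr rfl fun u _ => ?_
    rw [Finset.sum_image, matchSum, Finset.mul_sum]
    · refine Finset.sum_congr rfl fun N hN => ?_
      rw [Finset.card_insert_of_notMem (hcov u N hN), pow_succ']
    · intro N hN N' hN' h
      rw [← Finset.erase_insert (hcov u N hN), h, Finset.erase_insert (hcov u N' hN')]
  · intro u _ u' _ hne
    simp only [Function.onFun]
    rw [Finset.disjoint_left]
    intro M hM hM'
    obtain ⟨N, hN, rfl⟩ := Finset.mem_image.1 hM
    obtain ⟨N', hN', h⟩ := Finset.mem_image.1 hM'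
    have hmem : s(v, u') ∈ insert s(v, u) N := h ▸ Finset.mem_insert_self _ _
    rcases Finset.mem_insert.1 hmem with h1 | h1
    · exact hne (Sym2.congr_right.1 h1).symm
    · exact notMem_of_mem_matchingsIn hN (v := v) (by simp) (by simp) h1
  · rw [Finset.disjoint_left]
    intro M hM hM'
    obtain ⟨u, -, hM'⟩ := Finset.mem_biUnion.1 hM'
    obtain ⟨N, hN, rfl⟩ := Finset.mem_image.1 hM'
    exact notMem_of_mem_matchingsIn hM (v := v) (by simp) (e := s(v, u)) (by simp)
      (Finset.mem_insert_self _ _)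

theorem matchSum_empty (t : ℂ) : matchSum G t ∅ = 1 := by
  have : matchingsIn G ∅ = {∅} := by
    ext M
    rw [mem_matchingsIn, Finset.mem_singleton]
    constructor
    · intro h
      refine Finset.eq_empty_of_forall_notMem fun e he => ?_
      induction e with
      | _ a b => simpa using (h.1 _ he).2 a (by simp)
    · rintro rfl
      simp
  rw [matchSum, this]
  simp

/-- The Heilmann–Lieb argument. The ratio `Q = Z(S) / (s Z(S - v))` satisfies
`Q = 1 / s + ∑ 1 / Q_u` where the `Q_u` are ratios of the same kind for smaller sets, and
inversion preserves the right half plane. -/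
theorem matchSum_ne_zero_and_re_pos [DecidableEq V] {s : ℂ} (hs : 0 < s.re) (S : Finset V) :
    matchSum G (s ^ 2) S ≠ 0 ∧
      ∀ v ∈ S, 0 < (matchSum G (s ^ 2) S / (s * matchSum G (s ^ 2) (S.erase v))).re := by
  classical
  have hs0 : s ≠ 0 := by
    rintro rfl
    simp at hs
  have inv_re : ∀ z : ℂ, 0 < z.re → 0 < (z⁻¹).re := by
    intro z hz
    rw [Complex.inv_re]
    refine div_pos hz (Complex.normSq_pos.2 ?_)
    rintro rfl
    simp at hz
  induction S using Finset.strongInduction with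
  | H S ih =>
    have key : ∀ v ∈ S,
        0 < (matchSum G (s ^ 2) S / (s * matchSum G (s ^ 2) (S.erase v))).re := by
      intro v hv
      obtain ⟨h0, hpos⟩ := ih _ (Finset.erase_ssubset hv)
      have : matchSum G (s ^ 2) S / (s * matchSum G (s ^ 2) (S.erase v)) =
          s⁻¹ + ∑ u ∈ (S.erase v).filter (G.Adj v),
            (matchSum G (s ^ 2) (S.erase v) /
              (s * matchSum G (s ^ 2) ((S.erase v).erase u)))⁻¹ := by
        rw [matchSum_eq_add (s ^ 2) hv]
        simp_rw [inv_div, ← Finset.sum_div, ← Finset.mul_sum]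
        field_simp
      rw [this, Complex.add_re, Complex.re_sum]
      refine add_pos_of_pos_of_nonneg (inv_re _ hs) (Finset.sum_nonneg fun u hu => ?_)
      exact (inv_re _ (hpos u (Finset.mem_filter.1 hu).1)).le
    refine ⟨?_, key⟩
    rcases S.eq_empty_or_nonempty with rfl | ⟨v, hv⟩
    · simp [matchSum_empty]
    · intro h
      have := key v hv
      rw [h] at this
      simp at this

theorem two_mul_card_le [DecidableEq V] {k : ℕ} {M : Finset (Sym2 V)} (hM : IsKMatching G k M) :
    2 * k ≤ Fintype.card V := by
  obtain ⟨h1, rfl, h2⟩ := hM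
  have h : (M.biUnion Sym2.toFinset).card = ∑ e ∈ M, e.toFinset.card := by
    refine Finset.card_biUnion fun e he f hf hne => Finset.disjoint_left.2 fun v hv hv' => ?_
    exact h2 e he f hf hne v ⟨Sym2.mem_toFinset.1 hv, Sym2.mem_toFinset.1 hv'⟩
  rw [Finset.sum_congr rfl (fun e he => Sym2.card_toFinset_of_not_isDiag e
    (G.not_isDiag_of_mem_edgeSet (h1 e he))), Finset.sum_const, smul_eq_mul] at h
  rw [mul_comm, ← h]
  exact Finset.card_le_univ _

theorem aeval_genPoly (G : SimpleGraph V) (t : ℂ) :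
    aeval t (genPoly G) = matchSum G t Finset.univ := by
  classical
  rw [genPoly, map_sum, matchSum,
    ← Finset.sum_fiberwise_of_maps_to (g := Finset.card)
      (t := Finset.range (Fintype.card V / 2 + 1))]
  · refine Finset.sum_congr rfl fun k _ => ?_
    rw [Finset.sum_congr rfl (g := fun _ => t ^ k)
      (fun M hM => by rw [(Finset.mem_filter.1 hM).2])]
    rw [Finset.sum_const, nsmul_eq_mul]
    have : numMatchings G k = ((matchingsIn G Finset.univ).filter (·.card = k)).card := by
      rw [numMatchings, ← Set.ncard_coe_finset]
      congr 1
      ext M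
      simp only [Set.mem_ofPred_eq, IsKMatching, Finset.coe_filter, mem_matchingsIn,
        Finset.mem_univ, implies_true, and_true]
      tauto
    simp [this]
  · intro M hM
    rw [mem_matchingsIn] at hM
    have := two_mul_card_le (G := G) (k := M.card) (M := M) ⟨fun e he => (hM.1 e he).1, rfl, hM.2⟩
    rw [Finset.mem_range]
    omega

/-- The Heilmann–Lieb theorem: the complex zeros of the matching generating function lie on the
negative real axis. -/
theorem exists_neg_of_aeval_genPoly_eq_zero {t : ℂ} (ht : aeval t (genPoly G) = 0) :
    ∃ r : ℝ, r < 0 ∧ (r : ℂ) = t := by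
  classical
  by_contra! h
  have hts : t ∈ Complex.slitPlane ∨ t = 0 := by
    rw [or_iff_not_imp_right]
    intro h0
    rw [Complex.mem_slitPlane_iff]
    by_contra! h'
    refine h t.re (lt_of_le_of_ne h'.1 fun hre => h0 (Complex.ext hre h'.2)) ?_
    exact Complex.ext rfl (by simp [h'.2])
  rcases hts with hts | rfl
  · have hs : 0 < (t ^ (1 / 2 : ℂ)).re := by
      have ht0 := Complex.slitPlane_ne_zero hts
      rw [Complex.cpow_def_of_ne_zero ht0, Complex.exp_re]
      refine mul_pos (Real.exp_pos _) (Real.cos_pos_of_mem_Ioo ?_)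
      have h1 := Complex.neg_pi_lt_arg t
      have h2 := (Complex.arg_le_pi t).lt_of_ne (Complex.mem_slitPlane_iff_arg.1 hts).1
      have : (Complex.log t * (1 / 2)).im = t.arg / 2 := by
        rw [show (1 / 2 : ℂ) = ((1 / 2 : ℝ) : ℂ) by norm_num, Complex.im_mul_ofReal,
          Complex.log_im]
        ring
      rw [this]
      constructor <;> linarith
    have := (matchSum_ne_zero_and_re_pos (G := G) hs Finset.univ).1
    rw [← Complex.cpow_nat_mul] at this
    norm_num at this
    rw [aeval_genPoly] at ht
    exact this ht
  · have := (matchSum_ne_zero_and_re_pos (G := G) (s := 1) (by simp) ∅).1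
    have h0 : aeval (0 : ℂ) (genPoly G) = (numMatchings G 0 : ℂ) := by
      rw [genPoly, map_sum, Finset.sum_eq_single 0]
      · simp
      · intro k _ hk
        simp [hk]
      · simp
    rw [h0, numMatchings_zero] at ht
    simp at ht

end Matchings

/-! ### The numbers `γ_k` -/

namespace Matchings

variable {V : Type*} [Fintype V] {G : SimpleGraph V} {n : ℕ} {γ : ℕ → ℝ}

theorem coeff_genPoly (G : SimpleGraph V) {k : ℕ} (hk : k ≤ Fintype.card V / 2) :
    (genPoly G).coeff k = numMatchings G k := by
  rw [genPoly, finsetSum_coeff, Finset.sum_eq_single k]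
  · simp
  · intro j _ hj
    simp [coeff_X_pow, hj.symm]
  · intro h
    exact absurd (Finset.mem_range.2 (Nat.lt_succ_of_le hk)) h

theorem natDegree_genPoly (hV : Fintype.card V = 2 * n) (hn : 0 < numMatchings G n) :
    (genPoly G).natDegree = n := by
  have h2 : Fintype.card V / 2 = n := by omega
  refine natDegree_eq_of_le_of_coeff_ne_zero ?_ ?_
  · rw [genPoly, h2]
    refine natDegree_sum_le_of_forall_le _ _ fun k hk => ?_
    exact (natDegree_C_mul_X_pow_le _ _).trans (Nat.lt_succ_iff.1 (Finset.mem_range.1 hk))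
  · rw [coeff_genPoly G h2.ge]
    exact_mod_cast hn.ne'

theorem eval_genPoly_pos (G : SimpleGraph V) {t : ℝ} (ht : 0 ≤ t) : 0 < (genPoly G).eval t := by
  have hne : ∀ t : ℝ, 0 ≤ t → (genPoly G).eval t ≠ 0 := by
    intro t ht h
    obtain ⟨r, hr, hrt⟩ := exists_neg_of_aeval_genPoly_eq_zero (G := G) (t := (t : ℂ)) (by
      rw [← Complex.coe_algebraMap, aeval_algebraMap_apply, coe_aeval_eq_eval, h, map_zero])
    rw [Complex.ofReal_inj.1 hrt] at hr
    linarith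
  refine lt_of_le_of_ne ?_ (hne t ht).symm
  rw [genPoly, eval_finsetSum]
  refine Finset.sum_nonneg fun k _ => ?_
  simp only [eval_mul, eval_C, eval_pow, eval_X]
  positivity

theorem eval_zero_genPoly (G : SimpleGraph V) : (genPoly G).eval 0 = 1 := by
  rw [← coeff_zero_eq_eval_zero, coeff_genPoly G (Nat.zero_le _), numMatchings_zero, Nat.cast_one]

theorem splits_genPoly (G : SimpleGraph V) : (genPoly G).Splits := by
  refine Splits.of_splits_map (algebraMap ℝ ℂ) (IsAlgClosed.splits _) fun a ha => ?_
  have h := (mem_roots'.1 ha).2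
  rw [IsRoot.def, eval_map_algebraMap] at h
  obtain ⟨r, -, hr⟩ := exists_neg_of_aeval_genPoly_eq_zero h
  exact ⟨r, hr⟩

/-- A graph with a perfect matching has the numbers `γ_k`, and they are positive: they are the
negatives of the inverse zeros of the matching generating function, in increasing order. -/
theorem exists_isGammaSeq (hV : Fintype.card V = 2 * n) (hn : 0 < numMatchings G n) :
    ∃ γ : ℕ → ℝ, IsGammaSeq G n γ ∧ ∀ k ∈ Finset.Icc 1 n, 0 < γ k := by
  have hsp := splits_genPoly G
  have hcard : (genPoly G).roots.card = n := by
    rw [← hsp.natDegree_eq_card_roots, natDegree_genPoly hV hn]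
  have hneg : ∀ r ∈ (genPoly G).roots, r < 0 := by
    intro r hr
    by_contra! h
    exact (eval_genPoly_pos G h).ne' (mem_roots'.1 hr).2
  obtain ⟨f, hf⟩ : ∃ f : Fin n → ℝ, Multiset.map f Finset.univ.val = (genPoly G).roots := by
    obtain ⟨l, hl⟩ := Quot.exists_rep (genPoly G).roots
    rw [← hl] at hcard ⊢
    obtain rfl : l.length = n := hcard
    exact ⟨l.get, by rw [Fin.univ_val_map, List.ofFn_get]; rfl⟩
  have hfneg : ∀ i, f i < 0 := fun i => hneg _ (hf ▸ Multiset.mem_map_of_mem f (by simp))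
  set h : Fin n → ℝ := fun i => -(f i)⁻¹ with hdef
  have hpos : ∀ i, 0 < h i := fun i => neg_pos.2 (inv_lt_zero.2 (hfneg i))
  have hprod : genPoly G = ∏ i, (1 + C (h i) * X) := by
    have h1 : genPoly G = C (genPoly G).leadingCoeff * ∏ i, (X - C (f i)) := by
      conv_lhs => rw [hsp.eq_prod_roots, ← hf, Multiset.map_map]
      rfl
    have h2 : ∀ i, (X - C (f i)) = C (-f i) * (1 + C (h i) * X) := by
      intro i
      rw [mul_add, ← mul_assoc, ← C_mul, hdef]
      have : -f i * -(f i)⁻¹ = 1 := by rw [neg_mul_neg, mul_inv_cancel₀ (hfneg i).ne]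
      simp only [this, C_neg, C_1]
      ring
    simp_rw [h2, Finset.prod_mul_distrib, ← map_prod, ← mul_assoc, ← C_mul] at h1
    have h3 := congrArg (eval 0) h1
    rw [eval_zero_genPoly, eval_mul, eval_C, eval_prod] at h3
    simp only [eval_add, eval_one, eval_mul, eval_C, eval_X, mul_zero, add_zero,
      Finset.prod_const_one, mul_one] at h3
    rw [h1, ← h3, C_1, one_mul]
  have hmono := Tuple.monotone_sort h
  refine ⟨fun k => if hk : k - 1 < n then h (Tuple.sort h ⟨k - 1, hk⟩) else 0,
    ⟨hV, ?_, ?_⟩, ?_⟩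
  · intro a ha b hb hab
    simp only [Set.mem_Icc] at ha hb
    simp only [show a - 1 < n by omega, show b - 1 < n by omega, dif_pos]
    exact hmono (Fin.mk_le_mk.2 (by omega))
  · rw [hprod, ← Equiv.prod_comp (Tuple.sort h), ← Finset.Ico_add_one_right_eq_Icc,
      Finset.prod_Ico_eq_prod_range, add_tsub_cancel_right, Finset.prod_range]
    refine Finset.prod_congr rfl fun i _ => ?_
    simp
  · intro k hk
    rw [Finset.mem_Icc] at hk
    simp only [show k - 1 < n by omega, dif_pos]
    exact hpos _

/-- Comparison of the two leading coefficients of `∏ (1 + γ_j X)`: their ratio is `∑ 1 / γ_j`,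
hence at most `|s| / g` when all `γ_j ≥ g`. -/
theorem mul_coeff_prod_le {ι : Type*} (s : Finset ι) (a : ι → ℝ) (g : ℝ) (ha : ∀ i ∈ s, g ≤ a i)
    (ha0 : ∀ i ∈ s, 0 ≤ a i) :
    (∏ i ∈ s, (1 + C (a i) * X)).coeff s.card = ∏ i ∈ s, a i ∧
      ∀ m, m + 1 = s.card →
        g * (∏ i ∈ s, (1 + C (a i) * X)).coeff m ≤ s.card * ∏ i ∈ s, a i := by
  classical
  induction s using Finset.induction_on with
  | empty => simp
  | insert j s hj ih =>
    obtain ⟨ih1, ih2⟩ := ih (fun i hi => ha i (Finset.mem_insert_of_mem hi))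
      (fun i hi => ha0 i (Finset.mem_insert_of_mem hi))
    have hj0 := ha0 j (Finset.mem_insert_self _ _)
    have hjg := ha j (Finset.mem_insert_self _ _)
    have hs0 : 0 ≤ ∏ i ∈ s, a i :=
      Finset.prod_nonneg fun i hi => ha0 i (Finset.mem_insert_of_mem hi)
    have hdeg : (∏ i ∈ s, (1 + C (a i) * X)).natDegree ≤ s.card := by
      refine (natDegree_prod_le _ _).trans ((Finset.sum_le_sum fun i _ => ?_).trans_eq
        (Finset.card_eq_sum_ones s).symm)
      compute_degree
    have hcoeff : ∀ m, ((1 + C (a j) * X) * ∏ i ∈ s, (1 + C (a i) * X)).coeff (m + 1) =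
        (∏ i ∈ s, (1 + C (a i) * X)).coeff (m + 1) +
          a j * (∏ i ∈ s, (1 + C (a i) * X)).coeff m := by
      intro m
      rw [add_mul, one_mul, coeff_add, mul_assoc, coeff_C_mul, coeff_X_mul]
    rw [Finset.prod_insert hj, Finset.prod_insert hj, Finset.card_insert_of_notMem hj]
    refine ⟨?_, fun m hm => ?_⟩
    · rw [hcoeff, coeff_eq_zero_of_natDegree_lt (Nat.lt_succ_of_le hdeg), ih1, zero_add]
    · obtain rfl : m = s.card := by omega
      rcases hs : s.card with _ | m
      · obtain rfl := Finset.card_eq_zero.1 hs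
        simpa using hjg
      · rw [hcoeff, ← hs, ih1]
        have := mul_le_mul_of_nonneg_left (ih2 m hs.symm) hj0
        have := mul_le_mul_of_nonneg_right hjg hs0
        push_cast
        linarith

theorem gamma_one_mul_numMatchings_le (hγ : IsGammaSeq G n γ) (hpos : ∀ k ∈ Finset.Icc 1 n, 0 < γ k)
    (hn : 1 ≤ n) :
    γ 1 * numMatchings G (n - 1) ≤ n * numMatchings G n := by
  obtain ⟨hV, hmono, hprod⟩ := hγ
  obtain ⟨h1, h2⟩ := mul_coeff_prod_le (Finset.Icc 1 n) γ (γ 1) (fun i hi => by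
    rw [Finset.mem_Icc] at hi
    exact hmono ⟨le_rfl, hn⟩ hi hi.1) (fun i hi => (hpos i hi).le)
  have hc : (Finset.Icc 1 n).card = n := by simp
  have h3 := h2 (n - 1) (by omega)
  rw [← h1, ← hprod, hc, coeff_genPoly G (by omega), coeff_genPoly G (by omega)] at h3
  exact h3

end Matchings

/-! ### Derivatives of the entropy and gap functions -/

namespace Matchings

variable {V : Type*} [Fintype V] {G : SimpleGraph V} {n : ℕ} {γ : ℕ → ℝ}

theorem cast_card_eq_and_pos (hV : Fintype.card V = 2 * n) (hn : 1 ≤ n) :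
    (Fintype.card V : ℝ) = 2 * n ∧ (0 : ℝ) < n := by
  refine ⟨by rw [hV]; push_cast; ring, by exact_mod_cast hn⟩

theorem matchingNumber_eq (hV : Fintype.card V = 2 * n) (hm : 0 < numMatchings G n) :
    matchingNumber G = n := by
  classical
  have hle : ∀ k ∈ {k : ℕ | ∃ M : Finset (Sym2 V), IsKMatching G k M}, k ≤ n := by
    rintro k ⟨M, hM⟩
    have := two_mul_card_le hM
    omega
  obtain ⟨M, hM⟩ := Set.nonempty_of_ncard_ne_zero hm.ne'
  exact le_antisymm (csSup_le ⟨n, M, hM⟩ hle) (le_csSup ⟨n, hle⟩ ⟨M, hM⟩)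

theorem maxDensity_eq_one (hV : Fintype.card V = 2 * n) (hn : 1 ≤ n)
    (hm : 0 < numMatchings G n) : maxDensity G = 1 := by
  obtain ⟨h1, h2⟩ := cast_card_eq_and_pos hV hn
  rw [maxDensity, matchingNumber_eq hV hm, h1, div_self (by positivity)]

theorem density_eq_sum (hγ : IsGammaSeq G n γ) (hpos : ∀ k ∈ Finset.Icc 1 n, 0 < γ k)
    (hn : 1 ≤ n) {t : ℝ} (ht : 0 ≤ t) :
    density G t = (∑ k ∈ Finset.Icc 1 n, (1 - (1 + γ k * t)⁻¹)) / n := by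
  obtain ⟨h1, h2⟩ := cast_card_eq_and_pos hγ.1 hn
  have hd : (derivative (genPoly G)).eval t / (genPoly G).eval t =
      ∑ k ∈ Finset.Icc 1 n, γ k / (1 + γ k * t) := by
    have h := logDeriv_prod (s := Finset.Icc 1 n) (f := fun k (t : ℝ) => 1 + γ k * t) (x := t)
      (fun k hk => by have := hpos k hk; positivity) (fun k _ => by fun_prop)
    have hfun : (fun x => ∏ k ∈ Finset.Icc 1 n, (1 + γ k * x)) = fun x => (genPoly G).eval x := by
      ext x
      rw [hγ.2.2, eval_prod]
      simp
    rw [hfun, logDeriv_apply, Polynomial.deriv] at h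
    rw [h]
    refine Finset.sum_congr rfl fun k _ => ?_
    rw [logDeriv_apply]
    simp
  have hM := eval_genPoly_pos G ht
  have : density G t = t * ((derivative (genPoly G)).eval t / (genPoly G).eval t) / n := by
    rw [density, h1]
    field_simp
  rw [this, hd, Finset.mul_sum]
  congr 1
  refine Finset.sum_congr rfl fun k hk => ?_
  have := hpos k hk
  field_simp
  ring

theorem strictMonoOn_density (hγ : IsGammaSeq G n γ) (hpos : ∀ k ∈ Finset.Icc 1 n, 0 < γ k)
    (hn : 1 ≤ n) : StrictMonoOn (density G) (Set.Ici 0) := by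
  intro s hs t ht hst
  rw [Set.mem_Ici] at hs ht
  obtain ⟨h1, h2⟩ := cast_card_eq_and_pos hγ.1 hn
  rw [density_eq_sum hγ hpos hn hs, density_eq_sum hγ hpos hn ht]
  refine div_lt_div_of_pos_right (Finset.sum_lt_sum_of_nonempty ⟨1, by simp [hn]⟩ fun k hk => ?_) h2
  have := hpos k hk
  gcongr

theorem exists_hasStrictDerivAt_density (hγ : IsGammaSeq G n γ)
    (hpos : ∀ k ∈ Finset.Icc 1 n, 0 < γ k) (hn : 1 ≤ n) {t : ℝ} (ht : 0 < t) :
    ∃ D : ℝ, 0 < D ∧ HasStrictDerivAt (density G) D t := by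
  obtain ⟨h1, h2⟩ := cast_card_eq_and_pos hγ.1 hn
  refine ⟨(∑ k ∈ Finset.Icc 1 n, γ k / (1 + γ k * t) ^ 2) / n, ?_, ?_⟩
  · refine div_pos (Finset.sum_pos (fun k hk => ?_) ⟨1, by simp [hn]⟩) h2
    have := hpos k hk
    positivity
  · have h : HasStrictDerivAt (fun t => (∑ k ∈ Finset.Icc 1 n, (1 - (1 + γ k * t)⁻¹)) / (n : ℝ))
        ((∑ k ∈ Finset.Icc 1 n, γ k / (1 + γ k * t) ^ 2) / n) t := by
      refine HasStrictDerivAt.div_const (HasStrictDerivAt.fun_sum fun k hk => ?_) _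
      have hk := hpos k hk
      have hl : HasStrictDerivAt (fun t => 1 + γ k * t) (γ k) t := by
        simpa using ((hasStrictDerivAt_id t).const_mul (γ k)).const_add 1
      have := ((hasStrictDerivAt_inv (x := 1 + γ k * t) (by positivity)).comp t hl).const_sub 1
      refine this.congr_deriv ?_
      field_simp
    refine h.congr_of_eventuallyEq ?_
    filter_upwards [lt_mem_nhds ht] with s hs
    exact (density_eq_sum hγ hpos hn hs.le).symm

theorem density_pos_and_le_one_sub_density (hγ : IsGammaSeq G n γ)
    (hpos : ∀ k ∈ Finset.Icc 1 n, 0 < γ k) (hn : 1 ≤ n) {t : ℝ} (ht : 0 < t) :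
    0 < density G t ∧ (n * (1 + γ 1 * t))⁻¹ ≤ 1 - density G t := by
  obtain ⟨h1, h2⟩ := cast_card_eq_and_pos hγ.1 hn
  rw [density_eq_sum hγ hpos hn ht.le]
  constructor
  · refine div_pos (Finset.sum_pos (fun k hk => ?_) ⟨1, by simp [hn]⟩) h2
    have := hpos k hk
    rw [sub_pos]
    exact inv_lt_one_of_one_lt₀ (by nlinarith)
  · have h3 : (1 + γ 1 * t)⁻¹ ≤ ∑ k ∈ Finset.Icc 1 n, (1 + γ k * t)⁻¹ :=
      Finset.single_le_sum (f := fun k => (1 + γ k * t)⁻¹) (fun k hk => by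
        have := hpos k hk
        positivity) (Finset.mem_Icc.2 ⟨le_rfl, hn⟩)
    rw [Finset.sum_sub_distrib]
    simp only [Finset.sum_const, Nat.card_Icc, add_tsub_cancel_right, nsmul_eq_mul, mul_one]
    rw [sub_div, div_self h2.ne', sub_sub_cancel, mul_inv, ← div_eq_inv_mul]
    exact div_le_div_of_nonneg_right h3 h2.le

/-- `λ_G'(p) = -(ln t) / 2` at `p = p(G,t)`: the terms of `F'(t)` other than `-p'(t) (ln t) / 2`
cancel. -/
theorem hasDerivAt_entropy (hγ : IsGammaSeq G n γ) (hpos : ∀ k ∈ Finset.Icc 1 n, 0 < γ k)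
    (hn : 1 ≤ n) (hm : 0 < numMatchings G n) {t : ℝ} (ht : 0 < t) :
    HasDerivAt (entropy G) (-(Real.log t / 2)) (density G t) := by
  obtain ⟨h1, h2⟩ := cast_card_eq_and_pos hγ.1 hn
  obtain ⟨D, hD, hderiv⟩ := exists_hasStrictDerivAt_density hγ hpos hn ht
  have hM := eval_genPoly_pos G ht.le
  set φ := hderiv.localInverse (density G) D t hD.ne' with hφ
  have hφt : φ (density G t) = t := HasStrictFDerivAt.localInverse_apply_image _
  have hφd : HasDerivAt φ D⁻¹ (density G t) := (hderiv.to_localInverse hD.ne').hasDerivAt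
  have hF : HasDerivAt (freeEntropy G) (-(Real.log t / 2) * D) t := by
    have hlog := (((genPoly G).hasDerivAt t).log hM.ne').div_const (Fintype.card V : ℝ)
    have hmul := ((hderiv.hasDerivAt.const_mul (1 / 2)).mul (Real.hasDerivAt_log ht.ne'))
    refine HasDerivAt.congr_deriv (f := freeEntropy G) (hlog.sub hmul) ?_
    simp only [density, h1]
    field_simp
    ring
  have hcomp : HasDerivAt (freeEntropy G ∘ φ) (-(Real.log t / 2) * D * D⁻¹) (density G t) :=
    HasDerivAt.comp _ (by rwa [hφt]) hφd
  rw [mul_assoc, mul_inv_cancel₀ hD.ne', mul_one] at hcomp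
  refine hcomp.congr_of_eventuallyEq ?_
  have hlt : density G t < 1 := by
    have h3 := (density_pos_and_le_one_sub_density hγ hpos hn ht).2
    have h4 : 0 < γ 1 := hpos 1 (by simp [hn])
    have : 0 < (n * (1 + γ 1 * t))⁻¹ := by positivity
    linarith
  have hφpos : ∀ᶠ q in 𝓝 (density G t), 0 < φ q :=
    hφd.continuousAt.eventually (lt_mem_nhds (by rwa [hφt]))
  filter_upwards [hφpos, gt_mem_nhds hlt, hderiv.eventually_right_inverse hD.ne'] with q hq0 hq1 hq
  have hact : activity G q = φ q := by
    have := (strictMonoOn_density hγ hpos hn).injOn.leftInvOn_invFunOn (Set.mem_Ici.2 hq0.le)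
    rwa [hq] at this
  rw [entropy, maxDensity_eq_one hγ.1 hn hm, if_pos hq1, hact, Function.comp_apply]

theorem hasDerivAt_gurvits {d : ℕ} (hd : 1 ≤ d) {p : ℝ} (h0 : 0 < p) (h1 : p < 1) :
    HasDerivAt (gurvits d) (Real.log (d ^ 2 * (1 - p) ^ 2 / (p * (d - p))) / 2) p := by
  have hd0 : (1 : ℝ) ≤ d := by exact_mod_cast hd
  have hdp : 0 < d - p := by linarith
  have hq : 0 < 1 - p := by linarith
  have hpd : 0 < 1 - p / d := by
    rw [sub_pos, div_lt_one (by linarith)]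
    linarith
  have e1 : HasDerivAt (fun p : ℝ => (d : ℝ) / p) (-d / p ^ 2) p := by
    simpa [div_eq_mul_inv] using (hasDerivAt_inv h0.ne').const_mul (d : ℝ)
  have e2 : HasDerivAt (fun p : ℝ => 1 - p / d) (-(1 / d)) p :=
    ((hasDerivAt_id p).div_const (d : ℝ)).const_sub 1
  have e3 : HasDerivAt (fun p : ℝ => 1 - p) (-1) p := (hasDerivAt_id p).const_sub 1
  have e4 : HasDerivAt (fun p : ℝ => d - p) (-1) p := (hasDerivAt_id p).const_sub _
  have f1 := (hasDerivAt_id p).mul (e1.log (by positivity))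
  have f2 := e4.mul (e2.log hpd.ne')
  have f3 := (e3.const_mul 2).mul (e3.log hq.ne')
  have := ((f1.add f2).sub f3).const_mul (1 / 2)
  refine HasDerivAt.congr_deriv (f := gurvits d) this ?_
  have hpd' : 1 - p / d = (d - p) / d := by
    field_simp
  have hdne : (d : ℝ) ≠ 0 := by positivity
  simp only [id]
  rw [hpd', Real.log_div hdne h0.ne', Real.log_div hdp.ne' hdne,
    Real.log_div (x := d ^ 2 * (1 - p) ^ 2) (by positivity) (by positivity),
    Real.log_mul (by positivity) (by positivity), Real.log_mul h0.ne' hdp.ne', Real.log_pow,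
    Real.log_pow]
  field_simp
  push_cast
  ring

/-- A very small `γ₁` makes the gap function decrease. At `t = 1 / γ₁` the density still satisfies
`1 - p ≥ 1 / (2n)`, so that the derivative of Gurvits's function exceeds `-(ln t) / 2`. -/
theorem exists_hasDerivAt_gap_neg {d : ℕ} (hd : 1 ≤ d) (hγ : IsGammaSeq G n γ)
    (hpos : ∀ k ∈ Finset.Icc 1 n, 0 < γ k) (hn : 1 ≤ n) (hm : 0 < numMatchings G n)
    (hsmall : γ 1 < d / (4 * n ^ 2)) :
    ∃ p ∈ Set.Ioo (0 : ℝ) 1, ∃ g' : ℝ, HasDerivAt (gap d G) g' p ∧ g' < 0 := by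
  obtain ⟨-, h2⟩ := cast_card_eq_and_pos hγ.1 hn
  have hd0 : (1 : ℝ) ≤ d := by exact_mod_cast hd
  have hγ1 : 0 < γ 1 := hpos 1 (by simp [hn])
  have ht : 0 < (γ 1)⁻¹ := inv_pos.2 hγ1
  obtain ⟨hp0, hp1⟩ := density_pos_and_le_one_sub_density hγ hpos hn ht
  have hE := hasDerivAt_entropy hγ hpos hn hm ht
  set p := density G (γ 1)⁻¹
  rw [mul_inv_cancel₀ hγ1.ne'] at hp1
  have hp1' : 0 < 1 - p := lt_of_lt_of_le (by positivity) hp1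
  have hlt : p < 1 := by linarith
  have hdp : 0 < d - p := by linarith
  refine ⟨p, ⟨hp0, hlt⟩, _, hE.sub (hasDerivAt_gurvits hd hp0 hlt), ?_⟩
  have hlog : Real.log (γ 1) < Real.log (d ^ 2 * (1 - p) ^ 2 / (p * (d - p))) := by
    refine Real.log_lt_log hγ1 (hsmall.trans ?_)
    have h3 : p * (d - p) < d := by nlinarith
    have h4 : 1 ≤ (1 - p) * (2 * n) := by
      rw [inv_le_iff_one_le_mul₀ (by positivity)] at hp1
      linarith
    have h5 : 1 ≤ (1 - p) ^ 2 * (4 * n ^ 2) := by nlinarith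
    rw [div_lt_div_iff₀ (by positivity) (by positivity)]
    calc (d : ℝ) * (p * (d - p)) < d * d := by gcongr
      _ ≤ d * d * ((1 - p) ^ 2 * (4 * n ^ 2)) := le_mul_of_one_le_right (by positivity) h5
      _ = d ^ 2 * (1 - p) ^ 2 * (4 * n ^ 2) := by ring
  rw [Real.log_inv]
  linarith

theorem not_monotoneOn_of_hasDerivAt_neg {f : ℝ → ℝ} {p f' : ℝ} (hp : p ∈ Set.Ioo (0 : ℝ) 1)
    (hf : HasDerivAt f f' p) (hneg : f' < 0) : ¬ MonotoneOn f (Set.Icc 0 1) := by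
  intro hmono
  have h := hf.hasDerivWithinAt (s := Set.Icc 0 1)
  have hu : UniqueDiffWithinAt ℝ (Set.Icc (0 : ℝ) 1) p :=
    uniqueDiffOn_Icc one_pos p (Set.Ioo_subset_Icc_self hp)
  have := hmono.derivWithin_nonneg (x := p)
  rw [h.derivWithin hu] at this
  linarith

end Matchings

/-! ### Matchings of a bipartite graph as injective functions -/

namespace Matchings

variable {W : Type*}

/-- The bipartite graph with biadjacency relation `R`: two copies of `W`, with `b` in the left copy
joined to `a` in the right copy when `R b a`. -/
def biadjGraph (R : W → W → Prop) : SimpleGraph (W ⊕ W) where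
  Adj
    | .inl b, .inr a => R b a
    | .inr a, .inl b => R b a
    | _, _ => False
  symm := ⟨by rintro (b | a) (b' | a') h <;> exact h⟩
  loopless := ⟨by rintro (b | a) h <;> exact h⟩

variable {R : W → W → Prop}

@[simp]
theorem biadjGraph_adj_inl_inr {b a : W} : (biadjGraph R).Adj (.inl b) (.inr a) ↔ R b a := Iff.rfl

@[simp]
theorem biadjGraph_adj_inl_inl {b b' : W} : (biadjGraph R).Adj (.inl b) (.inl b') ↔ False := Iff.rfl

@[simp]
theorem biadjGraph_adj_inr_inr {a a' : W} : (biadjGraph R).Adj (.inr a) (.inr a') ↔ False := Iff.rfl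

theorem isBipartite_biadjGraph : (biadjGraph R).IsBipartite := by
  refine ⟨SimpleGraph.Coloring.mk (Sum.elim (fun _ => 0) (fun _ => 1)) ?_⟩
  rintro (b | a) (b' | a') h
  · exact absurd h id
  · simp
  · simp
  · exact absurd h id

/-- If the relation is the union of `d` edge-disjoint permutations, the graph is `d`-regular. -/
theorem isRegularOfDegree_biadjGraph [Fintype W] {d : ℕ} [DecidableRel (biadjGraph R).Adj]
    (π : Fin d → W → W) (hπ : ∀ y, (π y).Injective) (hπ' : ∀ b, Function.Injective fun y => π y b)
    (hR : ∀ b a, R b a ↔ ∃ y, π y b = a) : (biadjGraph R).IsRegularOfDegree d := by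
  classical
  rintro (b | a)
  · have : (biadjGraph R).neighborFinset (.inl b) =
        Finset.univ.image fun y => Sum.inr (π y b) := by
      ext (b' | a')
      · simp
      · simpa using hR b a'
    rw [SimpleGraph.degree, this, Finset.card_image_of_injective, Finset.card_univ,
      Fintype.card_fin]
    exact Sum.inr_injective.comp (hπ' b)
  · have hsurj : ∀ y, ∃ b, π y b = a := fun y => Finite.surjective_of_injective (hπ y) a
    choose b hb using hsurj
    have : (biadjGraph R).neighborFinset (.inr a) = Finset.univ.image fun y => Sum.inl (b y) := by
      ext (b' | a')
      · simp only [SimpleGraph.mem_neighborFinset, Finset.mem_image, Finset.mem_univ, true_and,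
          Sum.inl.injEq]
        refine (hR b' a).trans (exists_congr fun y => ?_)
        exact ⟨fun h => hπ y ((hb y).trans h.symm), fun h => h ▸ hb y⟩
      · simp
    rw [SimpleGraph.degree, this, Finset.card_image_of_injective, Finset.card_univ,
      Fintype.card_fin]
    intro y y' h
    refine hπ' (b y) ?_
    have h' : b y = b y' := Sum.inl_injective h
    simp only
    rw [hb y, h', hb y']

variable {U : Type*} [Fintype U]

open Classical in
/-- The set of edges joining `b u` on the left to `a u` on the right. -/
noncomputable def edgesOf (b a : U → W) : Finset (Sym2 (W ⊕ W)) :=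
  Finset.univ.image fun u => s(Sum.inl (b u), Sum.inr (a u))

theorem mem_edgesOf {b a : U → W} {e : Sym2 (W ⊕ W)} :
    e ∈ edgesOf b a ↔ ∃ u, s(Sum.inl (b u), Sum.inr (a u)) = e := by
  simp [edgesOf]

theorem isKMatching_edgesOf {b a : U → W} (hb : b.Injective) (ha : a.Injective)
    (hR : ∀ u, R (b u) (a u)) : IsKMatching (biadjGraph R) (Fintype.card U) (edgesOf b a) := by
  refine ⟨?_, ?_, ?_⟩
  · intro e he
    obtain ⟨u, rfl⟩ := mem_edgesOf.1 he
    exact hR u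
  · classical
    rw [edgesOf, Finset.card_image_of_injective, Finset.card_univ]
    intro u u' h
    have : b u = b u' ∧ a u = a u' := by simpa using h
    exact hb this.1
  · intro e he f hf hne v
    obtain ⟨u, rfl⟩ := mem_edgesOf.1 he
    obtain ⟨u', rfl⟩ := mem_edgesOf.1 hf
    have huu : u ≠ u' := by
      rintro rfl
      exact hne rfl
    rintro ⟨h1, h2⟩
    rcases v with v | v
    · simp only [Sym2.mem_iff, Sum.inl.injEq, reduceCtorEq, or_false] at h1 h2
      exact huu (hb (h1.symm.trans h2))
    · simp only [Sym2.mem_iff, Sum.inr.injEq, reduceCtorEq, false_or] at h1 h2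
      exact huu (ha (h1.symm.trans h2))

theorem edgesOf_injective {b : U → W} (hb : b.Injective) :
    Function.Injective (edgesOf b) := by
  intro a a' h
  funext u
  have : s(Sum.inl (b u), Sum.inr (a u)) ∈ edgesOf b a' := h ▸ mem_edgesOf.2 ⟨u, rfl⟩
  obtain ⟨u', hu'⟩ := mem_edgesOf.1 this
  have : b u' = b u ∧ a' u' = a u := by simpa using hu'
  rw [← this.2, hb this.1]

variable [Fintype W]

theorem card_le_numMatchings {b : U → W} (hb : b.Injective) :
    Nat.card {a : U → W // a.Injective ∧ ∀ u, R (b u) (a u)} ≤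
      numMatchings (biadjGraph R) (Fintype.card U) := by
  classical
  rw [numMatchings, ← Nat.card_coe_set_eq]
  refine Nat.card_le_card_of_injective
    (fun a => ⟨edgesOf b a.1, isKMatching_edgesOf hb a.2.1 a.2.2⟩) fun a a' h => ?_
  exact Subtype.ext (edgesOf_injective hb (congrArg Subtype.val h))

/-- Every perfect matching of a bipartite graph is the graph of an injective function. -/
theorem exists_edgesOf_eq {M : Finset (Sym2 (W ⊕ W))}
    (hM : IsKMatching (biadjGraph R) (Fintype.card W) M) :
    ∃ f : W → W, (f.Injective ∧ ∀ b, R b (f b)) ∧ edgesOf id f = M := by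
  classical
  obtain ⟨h1, h2, h3⟩ := hM
  have hform : ∀ e ∈ M, ∃ b a, R b a ∧ s(Sum.inl b, Sum.inr a) = e := by
    intro e he
    have := h1 e he
    induction e with
    | _ v w =>
      rcases v with b | a <;> rcases w with b' | a'
      · exact absurd this id
      · exact ⟨b, a', this, rfl⟩
      · exact ⟨b', a, this, Sym2.eq_swap⟩
      · exact absurd this id
  rcases isEmpty_or_nonempty W with hW | hW
  · rw [Fintype.card_eq_zero, Finset.card_eq_zero] at h2
    exact ⟨id, ⟨Function.injective_id, isEmptyElim⟩, by simp [edgesOf, h2]⟩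
  choose! l r hlr using hform
  have hinj : Set.InjOn l M := by
    intro e he f hf h
    by_contra hne
    refine h3 e he f hf hne (Sum.inl (l e)) ⟨?_, ?_⟩
    · simpa only [(hlr e he).2] using Sym2.mem_mk_left (Sum.inl (l e)) (Sum.inr (r e))
    · simpa only [(hlr f hf).2, h] using Sym2.mem_mk_left (Sum.inl (l f)) (Sum.inr (r f))
  have hcover : ∀ b, ∃ a, R b a ∧ s(Sum.inl b, Sum.inr a) ∈ M := by
    have himg : M.image l = Finset.univ := by
      rw [← Finset.card_eq_iff_eq_univ, Finset.card_image_of_injOn hinj, h2]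
    intro b
    obtain ⟨e, he, rfl⟩ := Finset.mem_image.1 (himg ▸ Finset.mem_univ b)
    exact ⟨r e, (hlr e he).1, by rwa [(hlr e he).2]⟩
  choose f hf hfM using hcover
  have hfinj : f.Injective := by
    intro b b' h
    by_contra hne
    refine h3 _ (hfM b) _ (hfM b') ?_ (Sum.inr (f b)) ⟨by simp, by simp [h]⟩
    intro h'
    have : b = b' ∧ f b = f b' := by simpa using h'
    exact hne this.1
  refine ⟨f, ⟨hfinj, hf⟩, Finset.eq_of_subset_of_card_le ?_ ?_⟩
  · intro e he
    obtain ⟨b, rfl⟩ := mem_edgesOf.1 he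
    exact hfM b
  · rw [h2, (isKMatching_edgesOf (R := R) Function.injective_id hfinj hf).2.1]

theorem numMatchings_le_card :
    numMatchings (biadjGraph R) (Fintype.card W) ≤
      Nat.card {f : W → W // f.Injective ∧ ∀ b, R b (f b)} := by
  classical
  rw [numMatchings, ← Nat.card_coe_set_eq]
  choose f hf hfM using fun M : {M | IsKMatching (biadjGraph R) (Fintype.card W) M} =>
    exists_edgesOf_eq M.2
  refine Nat.card_le_card_of_injective (fun M => ⟨f M, hf M⟩) fun M M' h => ?_
  rw [Subtype.ext_iff, ← hfM M, ← hfM M', show f M = f M' from congrArg Subtype.val h]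

end Matchings

/-! ### Chains of blocks -/

namespace Matchings

variable {d k : ℕ} [NeZero d]

/-- The vertices of the chains: `(c, i, x)` is the vertex number `x` on one side of the block
number `i` of the chain number `c`. -/
abbrev ChainVertex (d k : ℕ) : Type := Fin d × Fin (k + 1) × Fin d

/-- The right-hand vertex to which the left special vertex of block `i` of chain `c` is linked: the
special vertex of the next block, or the extra vertex `none` after the last block. -/
def chainNext (c : Fin d) (i : Fin (k + 1)) : Option (ChainVertex d k) :=
  if h : i.val + 1 < k + 1 then some (c, ⟨i.val + 1, h⟩, 0) else none

/-- The edge colouring of the chain graph: colour `y` sends a left vertex to the right vertex to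
which it is joined by the edge of colour `y`. Inside a block this is the cyclic colouring of
`K_{d,d}`, shifted so that the special vertices of a block of chain `c` would be joined in colour
`c`; that edge is replaced by the link to the next block. -/
def chainColor (y : Fin d) : Option (ChainVertex d k) → Option (ChainVertex d k)
  | none => some (y, 0, 0)
  | some (c, i, x) => if x = 0 ∧ c = y then chainNext c i else some (c, i, x + (y - c))

/-- The biadjacency relation of the chain graph: `d` chains of `k + 1` blocks, each a `K_{d,d}`
minus the edge of its special vertices, linked through the special vertices, with one extra left
vertex joined to the heads of all the chains and one extra right vertex joined to the tails. -/
def ChainRel (b a : Option (ChainVertex d k)) : Prop := ∃ y, chainColor y b = a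

theorem chainNext_injective {c c' : Fin d} {i i' : Fin (k + 1)}
    (h : chainNext c i = chainNext c' i') : i = i' := by
  have := i.2
  have := i'.2
  unfold chainNext at h
  split_ifs at h with h1 h2 h2
  · simp only [Option.some.injEq, Prod.mk.injEq, Fin.mk.injEq] at h
    exact Fin.ext (by omega)
  · exact Fin.ext (by omega)

theorem chainNext_eq_some {c : Fin d} {i : Fin (k + 1)} {w : ChainVertex d k}
    (h : chainNext c i = some w) : w.1 = c ∧ w.2.1.val = i.val + 1 ∧ w.2.2 = 0 := by
  unfold chainNext at h
  split_ifs at h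
  obtain rfl := Option.some_injective _ h
  exact ⟨rfl, rfl, rfl⟩

theorem chainColor_injective (y : Fin d) : Function.Injective (chainColor (k := k) y) := by
  rintro (_ | ⟨c, i, x⟩) (_ | ⟨c', i', x'⟩) h
  · rfl
  · simp only [chainColor] at h
    split_ifs at h with h1
    · have := (chainNext_eq_some h.symm).2.1
      simp at this
    · simp only [Option.some.injEq, Prod.mk.injEq] at h
      obtain ⟨rfl, -, h⟩ := h
      rw [sub_self, add_zero] at h
      exact absurd ⟨h.symm, rfl⟩ h1
  · simp only [chainColor] at h
    split_ifs at h with h1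
    · have := (chainNext_eq_some h).2.1
      simp at this
    · simp only [Option.some.injEq, Prod.mk.injEq] at h
      obtain ⟨rfl, -, h⟩ := h
      rw [sub_self, add_zero] at h
      exact absurd ⟨h, rfl⟩ h1
  · simp only [chainColor] at h
    split_ifs at h with h1 h2 h2
    · obtain ⟨rfl, rfl⟩ := h1
      obtain ⟨rfl, rfl⟩ := h2
      rw [chainNext_injective h]
    · obtain ⟨h3, -, h4⟩ := chainNext_eq_some h
      obtain ⟨rfl, rfl⟩ := h1
      simp only at h3 h4
      subst h3
      rw [sub_self, add_zero] at h4
      exact absurd ⟨h4, rfl⟩ h2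
    · obtain ⟨h3, -, h4⟩ := chainNext_eq_some h.symm
      obtain ⟨rfl, rfl⟩ := h2
      simp only at h3 h4
      subst h3
      rw [sub_self, add_zero] at h4
      exact absurd ⟨h4, rfl⟩ h1
    · simp only [Option.some.injEq, Prod.mk.injEq] at h
      obtain ⟨rfl, rfl, h⟩ := h
      rw [add_right_cancel h]

theorem chainColor_apply_injective (b : Option (ChainVertex d k)) :
    Function.Injective fun y => chainColor y b := by
  intro y y' h
  rcases b with _ | ⟨c, i, x⟩
  · simpa [chainColor] using h
  · simp only [chainColor] at h
    split_ifs at h with h1 h2 h2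
    · rw [← h1.2, h2.2]
    · have := (chainNext_eq_some h).2.1
      simp at this
    · have := (chainNext_eq_some h.symm).2.1
      simp at this
    · simp only [Option.some.injEq, Prod.mk.injEq, true_and] at h
      exact sub_left_injective (add_left_cancel h)

theorem chainRel_none {a : Option (ChainVertex d k)} (h : ChainRel none a) :
    ∃ c, a = some (c, 0, 0) := by
  obtain ⟨y, rfl⟩ := h
  exact ⟨y, rfl⟩

theorem chainRel_some {c : Fin d} {i : Fin (k + 1)} {x : Fin d} {a : Option (ChainVertex d k)}
    (h : ChainRel (some (c, i, x)) a) : (x = 0 ∧ a = chainNext c i) ∨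
      ∃ z, a = some (c, i, z) ∧ ¬ (x = 0 ∧ z = 0) := by
  obtain ⟨y, rfl⟩ := h
  simp only [chainColor]
  split_ifs with h1
  · exact .inl ⟨h1.1, rfl⟩
  · refine .inr ⟨_, rfl, ?_⟩
    rintro ⟨rfl, h2⟩
    rw [zero_add, sub_eq_zero] at h2
    exact h1 ⟨rfl, h2.symm⟩

theorem chainRel_block {c : Fin d} {i : Fin (k + 1)} {x z : Fin d} (h : ¬ (x = 0 ∧ z = 0)) :
    ChainRel (some (c, i, x)) (some (c, i, z)) := by
  refine ⟨z - x + c, ?_⟩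
  simp only [chainColor]
  rw [if_neg]
  · rw [add_sub_cancel_right, add_sub_cancel]
  · rintro ⟨rfl, h2⟩
    rw [sub_zero] at h2
    exact h ⟨rfl, right_eq_add.1 (by rwa [eq_comm] at h2 ⊢)⟩

variable {f : Option (ChainVertex d k) → Option (ChainVertex d k)}

/-- If the special right vertex of a block is matched from outside the block, then the special left
vertex is matched outside the block: there are not enough right vertices left in the block. -/
theorem apply_special_eq_chainNext (hf : f.Injective) (hR : ∀ b, ChainRel b (f b)) {c : Fin d}
    {i : Fin (k + 1)} (u : Option (ChainVertex d k)) (hu : f u = some (c, i, 0))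
    (hu' : ∀ x, u ≠ some (c, i, x)) : f (some (c, i, 0)) = chainNext c i := by
  by_contra hne
  have hblock : ∀ x, ∃ z, f (some (c, i, x)) = some (c, i, z) := by
    intro x
    rcases chainRel_some (hR (some (c, i, x))) with ⟨rfl, h⟩ | ⟨z, hz, -⟩
    · exact absurd h hne
    · exact ⟨z, hz⟩
  choose z hz using hblock
  have hzinj : z.Injective := by
    intro x x' h
    have := hf ((hz x).trans ((congrArg (fun z => some (c, i, z)) h).trans (hz x').symm))
    simpa using this
  obtain ⟨x, hx⟩ := Finite.surjective_of_injective hzinj 0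
  exact hu' x (hf (hu.trans (by rw [hz x, hx])))

/-- A perfect matching that uses the link to the head of chain `c` uses all the links of that
chain. -/
theorem exists_apply_eq_special (hf : f.Injective) (hR : ∀ b, ChainRel b (f b)) {c : Fin d}
    (hc : f none = some (c, 0, 0)) (i : Fin (k + 1)) :
    f (some (c, i, 0)) = chainNext c i ∧
      ∃ u, f u = some (c, i, 0) ∧ (u = none ∨ ∃ i', u = some (c, i', 0)) := by
  induction i using Fin.induction with
  | zero => exact ⟨apply_special_eq_chainNext hf hR none hc (by simp), none, hc, .inl rfl⟩
  | succ i ih =>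
    have h : f (some (c, i.castSucc, 0)) = some (c, i.succ, 0) := by
      rw [ih.1, chainNext, dif_pos (by simp)]
      rfl
    refine ⟨apply_special_eq_chainNext hf hR _ h fun x hx => ?_, _, h, .inr ⟨_, rfl⟩⟩
    have : i.castSucc = i.succ := by simp_all
    exact Fin.castSucc_lt_succ.ne this

/-- The chain vertex matched to `w` after all the links of chain `c` are removed and the special
vertices of each block of that chain are joined to each other. -/
def unlink (c : Fin d) (f : Option (ChainVertex d k) → Option (ChainVertex d k))
    (w : ChainVertex d k) : ChainVertex d k :=
  if w.1 = c ∧ w.2.2 = 0 then w else (f (some w)).getD w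

/-- The involution that exchanges, in each block `i` of chain `c`, the special vertex with the
vertex number `j i`. -/
def swapSpecial (c : Fin d) (j : Fin (k + 1) → {z : Fin d // z ≠ 0}) (w : ChainVertex d k) :
    ChainVertex d k :=
  if w.1 = c then (w.1, w.2.1, Equiv.swap 0 (j w.2.1).1 w.2.2) else w

theorem swapSpecial_involutive (c : Fin d) (j : Fin (k + 1) → {z : Fin d // z ≠ 0}) :
    Function.Involutive (swapSpecial c j) := by
  rintro ⟨c', i, x⟩
  by_cases h : c' = c <;> simp [swapSpecial, h]

theorem unlink_special (c : Fin d) (i : Fin (k + 1)) : unlink c f (c, i, 0) = (c, i, 0) := by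
  simp [unlink]

theorem some_unlink (hf : f.Injective) (hR : ∀ b, ChainRel b (f b)) {c : Fin d}
    (hc : f none = some (c, 0, 0)) {w : ChainVertex d k} (hw : ¬ (w.1 = c ∧ w.2.2 = 0)) :
    some (unlink c f w) = f (some w) := by
  rw [unlink, if_neg hw]
  rcases h : f (some w) with _ | v
  · have hlast : f (some (c, Fin.last k, 0)) = none := by
      rw [(exists_apply_eq_special hf hR hc _).1, chainNext, dif_neg (by simp)]
    obtain rfl := Option.some_injective _ (hf (h.trans hlast.symm))
    exact absurd ⟨rfl, rfl⟩ hw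
  · rfl

theorem unlink_injective (hf : f.Injective) (hR : ∀ b, ChainRel b (f b)) {c : Fin d}
    (hc : f none = some (c, 0, 0)) : (unlink c f).Injective := by
  have key : ∀ w v : ChainVertex d k, ¬ (w.1 = c ∧ w.2.2 = 0) → (v.1 = c ∧ v.2.2 = 0) →
      unlink c f w ≠ unlink c f v := by
    rintro w ⟨c', i, x⟩ hw ⟨hc', hx⟩ h
    simp only at hc' hx
    subst hc' hx
    obtain ⟨u, hu, hu'⟩ := (exists_apply_eq_special hf hR hc i).2
    have h1 := some_unlink hf hR hc hw
    rw [h, unlink_special, ← hu] at h1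
    rcases hu' with rfl | ⟨i', rfl⟩
    · exact absurd (hf h1) (by simp)
    · obtain rfl := Option.some_injective _ (hf h1)
      exact hw ⟨rfl, rfl⟩
  intro w v h
  by_cases hw : w.1 = c ∧ w.2.2 = 0 <;> by_cases hv : v.1 = c ∧ v.2.2 = 0
  · simpa only [unlink, if_pos hw, if_pos hv] using h
  · exact absurd h.symm (key v w hv hw)
  · exact absurd h (key w v hw hv)
  · have := congrArg some h
    rw [some_unlink hf hR hc hw, some_unlink hf hR hc hv] at this
    exact Option.some_injective _ (hf this)

/-- Exchanging the left end of the forbidden edge joining the special vertices with another left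
vertex of the block turns `unlink c f` into a matching of the chain graph. -/
theorem chainRel_unlink_swapSpecial (hf : f.Injective) (hR : ∀ b, ChainRel b (f b)) {c : Fin d}
    (hc : f none = some (c, 0, 0)) (j : Fin (k + 1) → {z : Fin d // z ≠ 0})
    (w : ChainVertex d k) : ChainRel (some w) (some (unlink c f (swapSpecial c j w))) := by
  obtain ⟨c', i, x⟩ := w
  by_cases hcc : c' = c
  · subst hcc
    by_cases hx0 : x = 0
    · subst hx0
      have hj : ¬ ((c', i, (j i).1).1 = c' ∧ (c', i, (j i).1).2.2 = 0) := fun h => (j i).2 h.2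
      have hsw : swapSpecial c' j (c', i, 0) = (c', i, (j i).1) := by simp [swapSpecial]
      have h1 := some_unlink hf hR hc hj
      rw [hsw, h1]
      rcases chainRel_some (hR (some (c', i, (j i).1))) with ⟨h, -⟩ | ⟨z, hz, -⟩
      · exact absurd h (j i).2
      · rw [hz]
        refine chainRel_block ?_
        rintro ⟨-, rfl⟩
        rw [hz, ← unlink_special (f := f) c' i] at h1
        have := unlink_injective hf hR hc (Option.some_injective _ h1)
        exact (j i).2 (by simpa using this)
    · by_cases hxj : x = (j i).1
      · have hsw : swapSpecial c' j (c', i, x) = (c', i, 0) := by simp [swapSpecial, hxj]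
        rw [hsw, unlink_special]
        exact chainRel_block fun h => hx0 h.1
      · have hsw : swapSpecial c' j (c', i, x) = (c', i, x) := by
          simp [swapSpecial, Equiv.swap_apply_of_ne_of_ne hx0 hxj]
        rw [hsw, some_unlink hf hR hc (fun h => hx0 h.2)]
        exact hR _
  · have hsw : swapSpecial c j (c', i, x) = (c', i, x) := by simp [swapSpecial, hcc]
    rw [hsw, some_unlink hf hR hc (fun h => hcc h.1)]
    exact hR _

/-- A perfect matching through chain `c`, together with a choice of a non-special vertex in each
block of that chain, is determined by `c` and the matching, avoiding the two extra vertices, that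
`unlink` and `swapSpecial` make of it. -/
theorem pow_mul_card_le (d k : ℕ) [NeZero d] :
    (d - 1) ^ (k + 1) * Nat.card {f : Option (ChainVertex d k) → Option (ChainVertex d k) //
        f.Injective ∧ ∀ b, ChainRel b (f b)} ≤
      d * Nat.card {a : ChainVertex d k → Option (ChainVertex d k) //
        a.Injective ∧ ∀ u, ChainRel (some u) (a u)} := by
  have h1 : (d - 1) ^ (k + 1) = Nat.card (Fin (k + 1) → {z : Fin d // z ≠ 0}) := by
    classical
    simp [Nat.card_eq_fintype_card]
  have h2 : ∀ n, d * n = Nat.card (Fin d) * n := by simp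
  rw [h1, h2, ← Nat.card_prod, ← Nat.card_prod]
  have hc : ∀ f : {f : Option (ChainVertex d k) → Option (ChainVertex d k) //
      f.Injective ∧ ∀ b, ChainRel b (f b)}, ∃ c, f.1 none = some (c, 0, 0) :=
    fun f => chainRel_none (f.2.2 none)
  choose c hc using hc
  refine Nat.card_le_card_of_injective
    (fun p => (c p.2, ⟨fun w => some (unlink (c p.2) p.2.1 (swapSpecial (c p.2) p.1 w)),
      (Option.some_injective _).comp ((unlink_injective p.2.2.1 p.2.2.2 (hc p.2)).comp
        (swapSpecial_involutive _ _).injective),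
      chainRel_unlink_swapSpecial p.2.2.1 p.2.2.2 (hc p.2) p.1⟩)) ?_
  rintro ⟨j, f⟩ ⟨j', f'⟩ h
  simp only [Prod.mk.injEq, Subtype.mk.injEq] at h
  obtain ⟨hcc, h⟩ := h
  have hcf' := hc f'
  have hcf := hc f
  rw [← hcc] at h hcf'
  generalize c f = c₀ at *
  have hw : ∀ w, unlink c₀ f.1 (swapSpecial c₀ j w) = unlink c₀ f'.1 (swapSpecial c₀ j' w) :=
    fun w => Option.some_injective _ (congrFun h w)
  -- The index `j i` is recovered as the partner of the special right vertex of block `i`.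
  have hj : j = j' := by
    funext i
    have e1 : swapSpecial c₀ j (c₀, i, (j i).1) = (c₀, i, 0) := by simp [swapSpecial]
    have e2 : swapSpecial c₀ j' (c₀, i, (j' i).1) = (c₀, i, 0) := by simp [swapSpecial]
    have h3 := hw (c₀, i, (j i).1)
    rw [e1, unlink_special, ← unlink_special (f := f'.1) c₀ i, ← e2] at h3
    have h4 := (swapSpecial_involutive _ _).injective
      (unlink_injective f'.2.1 f'.2.2 hcf' h3)
    exact Subtype.ext (by simpa using h4.symm)
  subst hj
  refine Prod.ext rfl (Subtype.ext (funext fun b => ?_))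
  simp only
  rcases b with _ | w
  · rw [hcf, hcf']
  · by_cases hs : w.1 = c₀ ∧ w.2.2 = 0
    · obtain ⟨c', i, x⟩ := w
      simp only at hs
      obtain ⟨rfl, rfl⟩ := hs
      rw [(exists_apply_eq_special f.2.1 f.2.2 hcf i).1,
        (exists_apply_eq_special f'.2.1 f'.2.2 hcf' i).1]
    · have h5 := hw (swapSpecial c₀ j w)
      rw [swapSpecial_involutive c₀ j w] at h5
      rw [← some_unlink f.2.1 f.2.2 hcf hs, ← some_unlink f'.2.1 f'.2.2 hcf' hs, h5]

end Matchings

/-! ### Exponential bounds -/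

namespace Matchings

theorem card_option_chainVertex (d k : ℕ) :
    Fintype.card (Option (ChainVertex d k)) = d ^ 2 * (k + 1) + 1 := by
  simp
  ring

theorem numMatchings_chain_pos (d k : ℕ) [NeZero d] :
    0 < numMatchings (biadjGraph (ChainRel (d := d) (k := k))) (d ^ 2 * (k + 1) + 1) := by
  rw [← card_option_chainVertex]
  refine lt_of_lt_of_le ?_ (card_le_numMatchings Function.injective_id)
  exact Nat.card_pos_iff.2
    ⟨⟨chainColor 0, chainColor_injective 0, fun u => ⟨0, rfl⟩⟩, inferInstance⟩

theorem pow_mul_numMatchings_chain_le (d k : ℕ) [NeZero d] :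
    (d - 1) ^ (k + 1) *
        numMatchings (biadjGraph (ChainRel (d := d) (k := k))) (d ^ 2 * (k + 1) + 1) ≤
      d * numMatchings (biadjGraph (ChainRel (d := d) (k := k))) (d ^ 2 * (k + 1)) := by
  have h1 := numMatchings_le_card (R := ChainRel (d := d) (k := k))
  have h2 := card_le_numMatchings (R := ChainRel (d := d) (k := k)) (Option.some_injective _)
  have h3 : Fintype.card (ChainVertex d k) = d ^ 2 * (k + 1) := by
    have := card_option_chainVertex d k
    rw [Fintype.card_option] at this
    omega
  rw [card_option_chainVertex] at h1
  rw [h3] at h2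
  exact (Nat.mul_le_mul_left _ h1).trans ((pow_mul_card_le d k).trans (Nat.mul_le_mul_left _ h2))

/-- The base `L` of the exponential bounds and the growth rate `q = L ^ (2 d²) = √2` per block; for
long chains `q` to the number of blocks dominates a cubic polynomial in `n`. -/
theorem exists_base_and_threshold (d : ℕ) (hd : 1 ≤ d) :
    ∃ L : ℝ, 1 < L ∧ (L ^ (2 * d ^ 2)) ^ 2 = 2 ∧ ∃ k₀ : ℕ, ∀ k ≥ k₀,
      4 * L ^ 2 * d * ((d ^ 2 * (k + 1) + 1 : ℕ) : ℝ) ^ 3 < (L ^ (2 * d ^ 2)) ^ (k + 1) := by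
  have hd0 : (0 : ℝ) < d := by exact_mod_cast hd
  set L : ℝ := 2 ^ (((4 * d ^ 2 : ℕ) : ℝ)⁻¹) with hL
  have hL1 : 1 < L := Real.one_lt_rpow one_lt_two (by positivity)
  have hpow : (L ^ (2 * d ^ 2)) ^ 2 = 2 := by
    rw [← pow_mul, show 2 * d ^ 2 * 2 = 4 * d ^ 2 by ring, hL]
    exact Real.rpow_inv_natCast_pow zero_le_two (by positivity)
  refine ⟨L, hL1, hpow, ?_⟩
  set q := L ^ (2 * d ^ 2)
  have hq1 : 1 < q := one_lt_pow₀ hL1 (by positivity)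
  set A : ℝ := 4 * L ^ 2 * d * (d ^ 2 + 1) ^ 3
  have hA : 0 < A := by positivity
  have h := (tendsto_pow_const_div_const_pow_of_one_lt 3 hq1).eventually
    (gt_mem_nhds (inv_pos.2 hA))
  obtain ⟨k₀, hk₀⟩ := eventually_atTop.1 h
  refine ⟨k₀, fun k hk => ?_⟩
  have h1 := hk₀ (k + 1) (by omega)
  have hqpos : 0 < q ^ (k + 1) := by positivity
  rw [div_lt_iff₀ hqpos, inv_mul_eq_div, lt_div_iff₀ hA] at h1
  refine lt_of_le_of_lt ?_ h1
  have hn : ((d ^ 2 * (k + 1) + 1 : ℕ) : ℝ) ≤ (d ^ 2 + 1) * ((k + 1 : ℕ) : ℝ) := by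
    push_cast
    nlinarith [(Nat.cast_nonneg k : (0 : ℝ) ≤ k)]
  calc 4 * L ^ 2 * d * ((d ^ 2 * (k + 1) + 1 : ℕ) : ℝ) ^ 3
      ≤ 4 * L ^ 2 * d * ((d ^ 2 + 1) * ((k + 1 : ℕ) : ℝ)) ^ 3 := by gcongr
    _ = ((k + 1 : ℕ) : ℝ) ^ 3 * A := by
        simp only [A]
        ring

end Matchings

open Matchings in
theorem mainTheorem6 (d : ℕ) (hd : 3 ≤ d) :
    ∃ (c K : ℝ) (V : ℕ → Type) (_ : ∀ i, Fintype (V i))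
      (H : ∀ i, SimpleGraph (V i)) (_ : ∀ i, DecidableRel (H i).Adj)
      (n : ℕ → ℕ) (γ : ℕ → ℕ → ℝ),
      0 < c ∧ c < 1 ∧ 1 < K ∧ StrictMono n ∧
      ∀ i,
        1 ≤ n i ∧ Fintype.card (V i) = 2 * n i ∧
        (H i).IsRegularOfDegree d ∧ (H i).IsBipartite ∧
        -- the smallest `γ` is exponentially small
        Matchings.IsGammaSeq (H i) (n i) (γ i) ∧
        γ i 1 < c ^ Fintype.card (V i) ∧
        -- the ratio `m_{n-1} / m_n` is exponentially large
        0 < Matchings.numMatchings (H i) (n i) ∧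
        K ^ (n i) < (Matchings.numMatchings (H i) (n i - 1) : ℝ) /
          (Matchings.numMatchings (H i) (n i) : ℝ) ∧
        -- the gap function has a negative derivative somewhere
        (∃ p₀ ∈ Set.Ioo (0 : ℝ) 1, ∃ g' : ℝ,
          HasDerivAt (Matchings.gap d (H i)) g' p₀ ∧ g' < 0) ∧
        -- the conclusions that hold for vertex-transitive graphs all fail
        ¬ MonotoneOn (Matchings.gap d (H i)) (Set.Icc 0 1) ∧
        γ i 1 < (d : ℝ) ^ 2 / (4 * ((d : ℝ) - 1)) * (1 / (n i : ℝ) ^ 2) ∧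
        2 / (d : ℝ) * (n i : ℝ) ^ 2 <
          (Matchings.numMatchings (H i) (n i - 1) : ℝ) /
            (Matchings.numMatchings (H i) (n i) : ℝ) := by
  classical
  have hne : NeZero d := ⟨by omega⟩
  have hd3 : (3 : ℝ) ≤ d := by exact_mod_cast hd
  obtain ⟨L, hL, hq2, k₀, hk₀⟩ := exists_base_and_threshold d (by omega)
  have hV : ∀ i, Fintype.card (Option (ChainVertex d (k₀ + i)) ⊕ Option (ChainVertex d (k₀ + i))) =
      2 * (d ^ 2 * (k₀ + i + 1) + 1) := by
    intro i
    rw [Fintype.card_sum, card_option_chainVertex]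
    ring
  have hm : ∀ i, 0 < numMatchings (biadjGraph (ChainRel (d := d) (k := k₀ + i)))
      (d ^ 2 * (k₀ + i + 1) + 1) := fun i => numMatchings_chain_pos d _
  choose γ hγ hpos using fun i => exists_isGammaSeq (hV i) (hm i)
  -- With `q = L ^ (2 d²)` and chains of `k` blocks, `L ^ (2n) = L² q ^ k` is smaller than
  -- `m_{n-1} / m_n ≥ 2 ^ k / d = q ^ (2k) / d` even after multiplication by a cubic in `n`, so
  -- `c = 1 / L` and `K = L` serve.
  refine ⟨L⁻¹, L, fun i => Option (ChainVertex d (k₀ + i)) ⊕ Option (ChainVertex d (k₀ + i)),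
    fun i => inferInstance, fun i => biadjGraph ChainRel, fun i => Classical.decRel _,
    fun i => d ^ 2 * (k₀ + i + 1) + 1, γ, by positivity, inv_lt_one_of_one_lt₀ hL, hL, ?_, ?_⟩
  · intro i j hij
    have : 0 < d ^ 2 := by positivity
    dsimp only
    gcongr
  · intro i
    dsimp only
    have hbig := hk₀ (k₀ + i) (by omega)
    have hcount := pow_mul_numMatchings_chain_le d (k₀ + i)
    have hγm := gamma_one_mul_numMatchings_le (hγ i) (hpos i) (by omega)
    have hm' := hm i
    rw [Nat.add_sub_cancel] at hγm ⊢
    rw [hV i]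
    set G := biadjGraph (ChainRel (d := d) (k := k₀ + i))
    set E : ℝ := (L ^ (2 * d ^ 2)) ^ (k₀ + i + 1) with hE
    have hE2 : E ^ 2 = 2 ^ (k₀ + i + 1) := by rw [hE, pow_right_comm, hq2]
    have hLn : L ^ (2 * (d ^ 2 * (k₀ + i + 1) + 1)) = L ^ 2 * E := by
      rw [hE, ← pow_mul, ← pow_add]
      congr 1
      ring
    have hn1 : (1 : ℝ) ≤ ((d ^ 2 * (k₀ + i + 1) + 1 : ℕ) : ℝ) := by
      exact_mod_cast Nat.le_add_left _ _
    have hn0 : 1 ≤ d ^ 2 * (k₀ + i + 1) + 1 := Nat.le_add_left _ _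
    have hE1 : 1 ≤ E := one_le_pow₀ (one_le_pow₀ hL.le)
    -- Hide the formula for `n - 1`, which plays no further role.
    have hγG := hγ i
    have hposG := hpos i
    have hVG := hV i
    generalize d ^ 2 * (k₀ + i + 1) = N at *
    set n : ℝ := ((N + 1 : ℕ) : ℝ) with hn
    have hmR : (0 : ℝ) < numMatchings G (N + 1) := by exact_mod_cast hm'
    set r : ℝ := (numMatchings G N : ℝ) / numMatchings G (N + 1) with hr
    have hrE : E ^ 2 / d ≤ r := by
      rw [hr, div_le_div_iff₀ (by positivity) hmR, hE2, mul_comm (numMatchings G N : ℝ)]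
      have h2 : (2 : ℕ) ^ (k₀ + i + 1) ≤ (d - 1) ^ (k₀ + i + 1) :=
        Nat.pow_le_pow_left (by omega) _
      exact_mod_cast (Nat.mul_le_mul_right _ h2).trans hcount
    have hr0 : 0 < r := lt_of_lt_of_le (by positivity) hrE
    have hγr : γ i 1 ≤ n * d / E ^ 2 := by
      have h1 : γ i 1 * r ≤ n := by
        rw [hr, mul_div_assoc', div_le_iff₀ hmR]
        exact hγm
      have h2 : γ i 1 * (E ^ 2 / d) ≤ n :=
        (mul_le_mul_of_nonneg_left hrE (hposG 1 (by simp)).le).trans h1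
      rw [le_div_iff₀ (by positivity)]
      rwa [mul_div_assoc', div_le_iff₀ (by positivity)] at h2
    have hL2 : 1 ≤ L ^ 2 := one_le_pow₀ hL.le
    have hn3 : n ≤ n ^ 3 := le_self_pow₀ hn1 (by norm_num)
    have hn23 : n ^ 2 ≤ n ^ 3 := pow_le_pow_right₀ hn1 (by norm_num)
    have hEE : E ≤ E ^ 2 := le_self_pow₀ hE1 (by norm_num)
    have b1 : n ^ 3 * (L ^ 2 * d) < E := by
      have : 0 < n ^ 3 * (L ^ 2 * d) := by positivity
      linarith
    have b2 : 4 * n ^ 3 < E ^ 2 := by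
      have : 1 ≤ L ^ 2 * d := by nlinarith
      have : 4 * n ^ 3 * 1 ≤ 4 * n ^ 3 * (L ^ 2 * d) := by gcongr
      linarith
    have hsmall : γ i 1 < d / (4 * n ^ 2) := by
      refine lt_of_le_of_lt hγr ?_
      rw [div_lt_div_iff₀ (by positivity) (by positivity)]
      calc n * d * (4 * n ^ 2) = d * (4 * n ^ 3) := by ring
        _ < d * E ^ 2 := by gcongr
    obtain ⟨p, hp, g', hg, hg'⟩ :=
      exists_hasDerivAt_gap_neg (d := d) (by omega) hγG hposG hn0 hm' hsmall
    refine ⟨hn0, rfl, ?_, isBipartite_biadjGraph, hγG, ?_, hm', ?_, ⟨p, hp, g', hg, hg'⟩,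
      not_monotoneOn_of_hasDerivAt_neg hp hg hg', ?_, ?_⟩
    · exact isRegularOfDegree_biadjGraph chainColor chainColor_injective
        chainColor_apply_injective fun b a => Iff.rfl
    · rw [inv_pow, hLn]
      refine lt_of_le_of_lt hγr ?_
      rw [div_lt_iff₀ (by positivity), inv_mul_eq_div, lt_div_iff₀ (by positivity)]
      calc n * d * (L ^ 2 * E) = n * (L ^ 2 * d) * E := by ring
        _ ≤ n ^ 3 * (L ^ 2 * d) * E := by gcongr
        _ < E * E := by gcongr
        _ = E ^ 2 := by ring
    · refine lt_of_lt_of_le ?_ hrE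
      rw [lt_div_iff₀ (by positivity)]
      calc L ^ (N + 1) * d ≤ L ^ (2 * (N + 1)) * d := by
            gcongr
            · exact hL.le
            · omega
        _ = 1 * (L ^ 2 * d) * E := by
            rw [hLn]
            ring
        _ ≤ n ^ 3 * (L ^ 2 * d) * E := by
            gcongr
            exact hn1.trans hn3
        _ < E * E := by gcongr
        _ = E ^ 2 := by ring
    · refine hsmall.trans_le ?_
      have hd1 : (0 : ℝ) < d - 1 := by linarith
      rw [div_mul_div_comm, mul_one, div_le_div_iff₀ (by positivity) (by positivity)]
      have : 0 ≤ 4 * d * n ^ 2 := by positivity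
      nlinarith
    · refine lt_of_lt_of_le ?_ hrE
      rw [div_mul_eq_mul_div]
      gcongr
      linarith
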